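/- Let $d \ge 0$ and $[d] = \{1,\dots,d\}$. A \emph{building set} on $[d]$ is a collection $\mathcal{B}$ of non-empty subsets of $[d]$ such that $I \cup J \in \mathcal{B}$ whenever $I, J \in \mathcal{B}$ and $I \cap J \neq \emptyset$. For non-empty $I \subseteq [d]$ let $\Delta_I = \mathrm{conv}(e_i : i \in I) \subset \mathbb{R}^d$, where $e_1,\dots,e_d$ is the standard basis. The \emph{nestohedron} of $\mathcal{B}$ is the Minkowski sum $\Delta_{\mathcal{B}} = \sum_{I \in \mathcal{B}} \Delta_I$ (the empty sum being $\{0\}$). A polytope in $\mathbb{R}^d$ is \emph{inscribed} if all its vertices lie on a common (Euclidean) sphere, that is, have the same distance to some point of $\mathbb{R}^d$. For $J \subseteq [d]$ let $\mathcal{B}|_J = \{I \in \mathcal{B} : I \subseteq J\}$, and for $i,j,k \in [d]$ let $n_{i,j}^k(\mathcal{B})$ be the number of $I \in \mathcal{B}$ with $i,j \in I$ and $k \notin I$. (1) Let $\mathcal{B}$ be a building set on $[d]$. The nestohedron $\Delta_{\mathcal{B}}$ is inscribed if and only if for all $J \subseteq [d]$ and all $i,j,k \in J$ the following holds: if $n_{i,j}^k(\mathcal{B}|_J)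 > 0$ and $n_{j,k}^i(\mathcal{B}|_J) > 0$, then $$n_{i,j}^k(\mathcal{B}|_J) = n_{j,k}^i(\mathcal{B}|_J) = n_{i,k}^j(\mathcal{B}|_J).$$ (2) Let $G$ be a simple graph on the vertex set $[d]$, and let $\mathcal{B}(G)$ be its graphical building set, which consists of all non-empty $I \subseteq [d]$ such that the induced subgraph $G[I]$ is connected. Then the graph associahedron $\Delta_{\mathcal{B}(G)}$ is inscribed if and only if $G$ is a disjoint union of complete graphs. -/

import Mathlib

open scoped Pointwise

/-- A building set on `[d]`: a collection of non-empty subsets such that the union of any two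
intersecting members is again a member. -/
structure IsBuildingSet {d : ℕ} (B : Finset (Finset (Fin d))) : Prop where
  nonempty : ∀ I ∈ B, I.Nonempty
  union_mem : ∀ I ∈ B, ∀ J ∈ B, (I ∩ J).Nonempty → I ∪ J ∈ B

/-- The simplex `Δ_I = conv (e_i : i ∈ I)` in `ℝ^d`. -/
def simplexFace {d : ℕ} (I : Finset (Fin d)) : Set (EuclideanSpace ℝ (Fin d)) :=
  convexHull ℝ ((fun i => EuclideanSpace.single i (1 : ℝ)) '' (I : Set (Fin d)))

/-- The Minkowski sum `Δ_B = ∑_{I ∈ B} Δ_I`; the empty sum is the point `{0}`. -/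
noncomputable def nestohedron {d : ℕ} (B : Finset (Finset (Fin d))) :
    Set (EuclideanSpace ℝ (Fin d)) :=
  ∑ I ∈ B, simplexFace I

/-- A polytope is inscribed if all its vertices (extreme points) lie on a common sphere. -/
def IsInscribed {d : ℕ} (P : Set (EuclideanSpace ℝ (Fin d))) : Prop :=
  EuclideanGeometry.Cospherical (P.extremePoints ℝ)

/-- The restriction `B|_J = {I ∈ B : I ⊆ J}`. -/
def restrictTo {d : ℕ} (B : Finset (Finset (Fin d))) (J : Finset (Fin d)) :
    Finset (Finset (Fin d)) :=
  B.filter (fun I => I ⊆ J)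

/-- `nCount B i j k` is `n_{i,j}^k(B)`, the number of `I ∈ B` with `i, j ∈ I` and `k ∉ I`. -/
def nCount {d : ℕ} (B : Finset (Finset (Fin d))) (i j k : Fin d) : ℕ :=
  (B.filter (fun I => i ∈ I ∧ j ∈ I ∧ k ∉ I)).card

open Classical in
/-- The graphical building set: all non-empty `I` for which the induced subgraph `G[I]` is
connected. -/
noncomputable def graphicalBuildingSet {d : ℕ} (G : SimpleGraph (Fin d)) :
    Finset (Finset (Fin d)) :=
  Finset.univ.filter (fun I => I.Nonempty ∧ (G.induce (I : Set (Fin d))).Connected)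

/-- `G` is a disjoint union of complete graphs: the vertex set is partitioned into blocks such
that two distinct vertices are adjacent exactly if they lie in the same block. -/
def IsDisjointUnionOfComplete {V : Type*} (G : SimpleGraph V) : Prop :=
  ∃ s : Setoid V, ∀ u v : V, G.Adj u v ↔ u ≠ v ∧ s u v

/-! ### Vertices of nestohedra -/

/-- The vertex of the nestohedron selected by the ranking `c`: its coordinate at `x` is the number
of members of `B` in which `x` has the largest rank. -/
noncomputable def rankVertex {d : ℕ} (B : Finset (Finset (Fin d))) (c : Fin d → ℕ) :
    EuclideanSpace ℝ (Fin d) :=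
  WithLp.toLp 2 fun x => ((B.filter fun I => x ∈ I ∧ ∀ y ∈ I, c y ≤ c x).card : ℝ)

theorem rankVertex_apply {d : ℕ} (B : Finset (Finset (Fin d))) (c : Fin d → ℕ) (x : Fin d) :
    rankVertex B c x = ((B.filter fun I => x ∈ I ∧ ∀ y ∈ I, c y ≤ c x).card : ℝ) := rfl

theorem simplexFace_coords {d : ℕ} {I : Finset (Fin d)} {y : EuclideanSpace ℝ (Fin d)}
    (hy : y ∈ simplexFace I) :
    (∀ x, 0 ≤ y x) ∧ (∀ x, x ∉ I → y x = 0) ∧ ∑ x, y x = 1 := by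
  have hsub : simplexFace I ⊆ {y : EuclideanSpace ℝ (Fin d) |
      (∀ x, 0 ≤ y x) ∧ (∀ x, x ∉ I → y x = 0) ∧ ∑ x, y x = 1} := by
    refine convexHull_min ?_ ?_
    · rintro _ ⟨i, hi, rfl⟩
      refine ⟨fun x => ?_, fun x hx => ?_, ?_⟩
      · simp only [PiLp.single_apply]
        split_ifs <;> norm_num
      · have : x ≠ i := by rintro rfl; exact hx hi
        simp [this]
      · simp
    · rintro u ⟨hu0, hu1, hu2⟩ v ⟨hv0, hv1, hv2⟩ p q hp hq hpq
      refine ⟨fun x => ?_, fun x hx => ?_, ?_⟩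
      · have := hu0 x
        have := hv0 x
        simp only [PiLp.add_apply, PiLp.smul_apply, smul_eq_mul]
        positivity
      · simp [hu1 x hx, hv1 x hx]
      · simp [Finset.sum_add_distrib, ← Finset.mul_sum, hu2, hv2, hpq]
  exact hsub hy

theorem simplexFace_gap {d : ℕ} {I : Finset (Fin d)} {y : EuclideanSpace ℝ (Fin d)}
    (hy : y ∈ simplexFace I) (a : Fin d → ℝ) (t : Fin d) :
    a t - ∑ x, a x * y x = ∑ x, (a t - a x) * y x := by
  simp [sub_mul, Finset.sum_sub_distrib, ← Finset.mul_sum, (simplexFace_coords hy).2.2]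

theorem simplexFace_gap_nonneg {d : ℕ} {I : Finset (Fin d)} {y : EuclideanSpace ℝ (Fin d)}
    (hy : y ∈ simplexFace I) {a : Fin d → ℝ} {t : Fin d} (h : ∀ x ∈ I, a x ≤ a t) (x : Fin d) :
    0 ≤ (a t - a x) * y x := by
  obtain ⟨h0, h1, -⟩ := simplexFace_coords hy
  by_cases hx : x ∈ I
  · exact mul_nonneg (sub_nonneg.2 (h x hx)) (h0 x)
  · simp [h1 x hx]

theorem sum_mul_le_of_mem_simplexFace {d : ℕ} {I : Finset (Fin d)}
    {y : EuclideanSpace ℝ (Fin d)} (hy : y ∈ simplexFace I) {a : Fin d → ℝ} {t : Fin d}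
    (h : ∀ x ∈ I, a x ≤ a t) : ∑ x, a x * y x ≤ a t := by
  have := simplexFace_gap hy a t
  have := Finset.sum_nonneg fun x (_ : x ∈ Finset.univ) => simplexFace_gap_nonneg hy h x
  linarith

theorem eq_single_of_mem_simplexFace {d : ℕ} {I : Finset (Fin d)}
    {y : EuclideanSpace ℝ (Fin d)} (hy : y ∈ simplexFace I) {a : Fin d → ℝ} {t : Fin d}
    (h : ∀ x ∈ I, a x ≤ a t) (hinj : Function.Injective a) (heq : ∑ x, a x * y x = a t) :
    y = EuclideanSpace.single t 1 := by
  have h1 := simplexFace_gap hy a t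
  rw [heq, sub_self, eq_comm,
    Finset.sum_eq_zero_iff_of_nonneg fun x _ => simplexFace_gap_nonneg hy h x] at h1
  have h2 : ∀ x, x ≠ t → y x = 0 := fun x hx =>
    (mul_eq_zero.1 (h1 x (Finset.mem_univ x))).resolve_left
      (sub_ne_zero.2 fun e => hx (hinj e.symm))
  have h3 : y t = 1 := by
    rw [← (simplexFace_coords hy).2.2, Finset.sum_eq_single t (fun x _ hx => h2 x hx) (by simp)]
  ext x
  by_cases hx : x = t
  · subst hx; simp [h3]
  · simp [h2 x hx, hx]

/-- The indicator vector of the elements of `I` with the largest rank. -/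
noncomputable def topVector {d : ℕ} (c : Fin d → ℕ) (I : Finset (Fin d)) :
    EuclideanSpace ℝ (Fin d) :=
  WithLp.toLp 2 fun x => if x ∈ I ∧ ∀ y ∈ I, c y ≤ c x then 1 else 0

theorem exists_topVector_eq_single {d : ℕ} {c : Fin d → ℕ} (hc : Function.Injective c)
    {I : Finset (Fin d)} (hI : I.Nonempty) :
    ∃ t ∈ I, (∀ x ∈ I, c x ≤ c t) ∧ topVector c I = EuclideanSpace.single t 1 := by
  obtain ⟨t, ht, hmax⟩ := Finset.exists_max_image I c hI
  refine ⟨t, ht, hmax, ?_⟩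
  ext x
  have : (x ∈ I ∧ ∀ y ∈ I, c y ≤ c x) ↔ x = t :=
    ⟨fun h => hc (le_antisymm (hmax x h.1) (h.2 t ht)), by rintro rfl; exact ⟨ht, hmax⟩⟩
  simp [topVector, this]

theorem rankVertex_eq_sum {d : ℕ} (B : Finset (Finset (Fin d))) (c : Fin d → ℕ) :
    rankVertex B c = ∑ I ∈ B, topVector c I := by
  ext x
  simp only [rankVertex_apply, topVector, WithLp.ofLp_sum, Finset.sum_apply, Finset.sum_boole]

theorem rankVertex_mem {d : ℕ} {B : Finset (Finset (Fin d))} (hB : ∀ I ∈ B, I.Nonempty)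
    {c : Fin d → ℕ} (hc : Function.Injective c) : rankVertex B c ∈ nestohedron B := by
  rw [rankVertex_eq_sum]
  refine Set.finsetSum_mem_finsetSum _ _ _ fun I hI => ?_
  obtain ⟨t, ht, -, h⟩ := exists_topVector_eq_single hc (hB I hI)
  exact subset_convexHull ℝ _ ⟨t, ht, h.symm⟩

theorem sum_mul_sum_apply {d : ℕ} (B : Finset (Finset (Fin d))) (a : Fin d → ℝ)
    (g : Finset (Fin d) → EuclideanSpace ℝ (Fin d)) :
    ∑ x, a x * (∑ I ∈ B, g I) x = ∑ I ∈ B, ∑ x, a x * g I x := by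
  simp only [WithLp.ofLp_sum, Finset.sum_apply, Finset.mul_sum]
  exact Finset.sum_comm

theorem sum_mul_le_topVector {d : ℕ} {I : Finset (Fin d)} (hI : I.Nonempty)
    {c : Fin d → ℕ} (hc : Function.Injective c) {a : Fin d → ℝ}
    (hac : ∀ x y, c x ≤ c y → a x ≤ a y) {y : EuclideanSpace ℝ (Fin d)}
    (hy : y ∈ simplexFace I) : ∑ x, a x * y x ≤ ∑ x, a x * topVector c I x := by
  obtain ⟨t, -, hmax, h⟩ := exists_topVector_eq_single hc hI
  rw [h]
  simpa [Pi.single_apply] using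
    sum_mul_le_of_mem_simplexFace hy fun x hx => hac _ _ (hmax x hx)

/-- A ranking compatible with a linear functional selects a maximizer of the functional. -/
theorem sum_mul_le_rankVertex {d : ℕ} {B : Finset (Finset (Fin d))} (hB : ∀ I ∈ B, I.Nonempty)
    {c : Fin d → ℕ} (hc : Function.Injective c) {a : Fin d → ℝ}
    (hac : ∀ x y, c x ≤ c y → a x ≤ a y) {y : EuclideanSpace ℝ (Fin d)}
    (hy : y ∈ nestohedron B) : ∑ x, a x * y x ≤ ∑ x, a x * rankVertex B c x := by
  obtain ⟨g, hg, rfl⟩ := (Set.mem_finsetSum _ _ _).1 hy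
  rw [rankVertex_eq_sum, sum_mul_sum_apply, sum_mul_sum_apply]
  exact Finset.sum_le_sum fun I hI => sum_mul_le_topVector (hB I hI) hc hac (hg hI)

theorem eq_rankVertex_of_sum_mul_eq {d : ℕ} {B : Finset (Finset (Fin d))}
    (hB : ∀ I ∈ B, I.Nonempty) {c : Fin d → ℕ} (hc : Function.Injective c)
    {y : EuclideanSpace ℝ (Fin d)} (hy : y ∈ nestohedron B)
    (heq : ∑ x, (c x : ℝ) * y x = ∑ x, (c x : ℝ) * rankVertex B c x) :
    y = rankVertex B c := by
  obtain ⟨g, hg, rfl⟩ := (Set.mem_finsetSum _ _ _).1 hy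
  rw [rankVertex_eq_sum, sum_mul_sum_apply, sum_mul_sum_apply] at heq
  rw [rankVertex_eq_sum]
  have h := (Finset.sum_eq_sum_iff_of_le fun I hI =>
    sum_mul_le_topVector (hB I hI) hc (fun _ _ => Nat.cast_le.2) (hg hI)).1 heq
  refine Finset.sum_congr rfl fun I hI => ?_
  obtain ⟨t, -, hmax, ht⟩ := exists_topVector_eq_single hc (hB I hI)
  have hI' := h I hI
  rw [ht] at hI' ⊢
  exact eq_single_of_mem_simplexFace (hg hI) (fun x hx => Nat.cast_le.2 (hmax x hx))
    (fun x y hxy => hc (Nat.cast_injective hxy)) (by simpa [Pi.single_apply] using hI')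

theorem rankVertex_mem_extremePoints {d : ℕ} {B : Finset (Finset (Fin d))}
    (hB : ∀ I ∈ B, I.Nonempty) {c : Fin d → ℕ} (hc : Function.Injective c) :
    rankVertex B c ∈ (nestohedron B).extremePoints ℝ := by
  refine mem_extremePoints_iff_left.2 ⟨rankVertex_mem hB hc, fun u hu v hv huv => ?_⟩
  obtain ⟨p, q, hp, hq, hpq, h⟩ := huv
  refine eq_rankVertex_of_sum_mul_eq hB hc hu ?_
  have hmono : ∀ x y, c x ≤ c y → (c x : ℝ) ≤ c y := fun x y => Nat.cast_le.2
  have h1 := sum_mul_le_rankVertex hB hc hmono hu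
  have h2 := sum_mul_le_rankVertex hB hc hmono hv
  have h3 : p * ∑ x, (c x : ℝ) * u x + q * ∑ x, (c x : ℝ) * v x
      = ∑ x, (c x : ℝ) * rankVertex B c x := by
    rw [← h, Finset.mul_sum, Finset.mul_sum, ← Finset.sum_add_distrib]
    refine Finset.sum_congr rfl fun x _ => ?_
    simp only [PiLp.add_apply, PiLp.smul_apply, smul_eq_mul]
    ring
  obtain rfl : q = 1 - p := by linarith
  nlinarith

theorem exists_perm_compatible {d : ℕ} (a : Fin d → ℝ) :
    ∃ σ : Equiv.Perm (Fin d), ∀ x y, σ x ≤ σ y → a x ≤ a y := by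
  refine ⟨(Tuple.sort a)⁻¹, fun x y h => ?_⟩
  simpa using Tuple.monotone_sort a h

theorem perm_val_injective {d : ℕ} (σ : Equiv.Perm (Fin d)) :
    Function.Injective fun x => (σ x : ℕ) :=
  Fin.val_injective.comp σ.injective

theorem nestohedron_subset_convexHull {d : ℕ} {B : Finset (Finset (Fin d))}
    (hB : ∀ I ∈ B, I.Nonempty) :
    nestohedron B ⊆ convexHull ℝ
      (Set.range fun σ : Equiv.Perm (Fin d) => rankVertex B fun x => (σ x : ℕ)) := by
  intro y hy
  by_contra hn
  obtain ⟨f, u, hfu, huy⟩ := geometric_hahn_banach_closed_point (convex_convexHull ℝ _)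
    ((Set.finite_range _).isClosed_convexHull ℝ) hn
  have hf : ∀ v : EuclideanSpace ℝ (Fin d),
      f v = ∑ x, f (EuclideanSpace.single x 1) * v x := by
    intro v
    conv_lhs => rw [← (EuclideanSpace.basisFun (Fin d) ℝ).sum_repr v]
    simp [mul_comm]
  obtain ⟨σ, hσ⟩ := exists_perm_compatible fun x => f (EuclideanSpace.single x (1 : ℝ))
  have h1 := sum_mul_le_rankVertex hB (perm_val_injective σ) hσ hy
  have h2 := hfu _ (subset_convexHull ℝ _ ⟨σ, rfl⟩)
  rw [← hf, ← hf] at h1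
  exact absurd (huy.trans_le h1) h2.not_gt

theorem convex_nestohedron {d : ℕ} (B : Finset (Finset (Fin d))) : Convex ℝ (nestohedron B) :=
  convex_sum _ fun _ _ => convex_convexHull ℝ _

theorem exists_perm_of_mem_extremePoints {d : ℕ} {B : Finset (Finset (Fin d))}
    (hB : ∀ I ∈ B, I.Nonempty) {v : EuclideanSpace ℝ (Fin d)}
    (hv : v ∈ (nestohedron B).extremePoints ℝ) :
    ∃ σ : Equiv.Perm (Fin d), rankVertex B (fun x => (σ x : ℕ)) = v := by
  have h : nestohedron B = convexHull ℝ
      (Set.range fun σ : Equiv.Perm (Fin d) => rankVertex B fun x => (σ x : ℕ)) := by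
    refine (nestohedron_subset_convexHull hB).antisymm (convexHull_min ?_ (convex_nestohedron B))
    rintro _ ⟨σ, rfl⟩
    exact rankVertex_mem hB (perm_val_injective σ)
  rw [h] at hv
  exact (extremePoints_convexHull_subset hv : v ∈ Set.range _)

/-! ### The edge criterion for inscribability -/

/-- The number of members of `B|_J` that contain `i`. -/
def degCount {d : ℕ} (B : Finset (Finset (Fin d))) (J : Finset (Fin d)) (i : Fin d) : ℕ :=
  ((restrictTo B J).filter fun I => i ∈ I).card

/-- The number of members of `B|_J` that contain `i` and `j`. -/
def pairCount {d : ℕ} (B : Finset (Finset (Fin d))) (J : Finset (Fin d)) (i j : Fin d) : ℕ :=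
  ((restrictTo B J).filter fun I => i ∈ I ∧ j ∈ I).card

theorem pairCount_comm {d : ℕ} (B : Finset (Finset (Fin d))) (J : Finset (Fin d))
    (i j : Fin d) : pairCount B J i j = pairCount B J j i := by
  simp only [pairCount, and_comm]

theorem degCount_eq {d : ℕ} (B : Finset (Finset (Fin d))) (J : Finset (Fin d)) (i j : Fin d) :
    degCount B J i = pairCount B J i j + nCount (restrictTo B J) i i j := by
  rw [degCount, pairCount, nCount, ← Finset.card_filter_add_card_filter_not (fun I => j ∈ I),
    Finset.filter_filter, Finset.filter_filter]
  simp

theorem dist_eq_dist_iff_of_edge {d : ℕ} {u v z : EuclideanSpace ℝ (Fin d)} {i j : Fin d}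
    (hij : i ≠ j) {m : ℝ} (hm : 0 ≤ m) (hi : v i = u i + m) (hj : u j = v j + m)
    (hx : ∀ x, x ≠ i → x ≠ j → v x = u x) :
    dist v z = dist u z ↔ (0 < m → z i - z j = u i - v j) := by
  rw [← sq_eq_sq₀ dist_nonneg dist_nonneg, EuclideanSpace.dist_sq_eq, EuclideanSpace.dist_sq_eq,
    ← sub_eq_zero, ← Finset.sum_sub_distrib, Fintype.sum_eq_add i j hij]
  · simp only [Real.dist_eq, sq_abs, hi, hj]
    have : (u i + m - z i) ^ 2 - (u i - z i) ^ 2 + ((v j - z j) ^ 2 - (v j + m - z j) ^ 2)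
      = 2 * m * (u i - v j - (z i - z j)) := by ring
    rw [this]
    constructor
    · intro h hm
      have := (mul_eq_zero.1 h).resolve_left (by positivity)
      linarith
    · intro h
      rcases hm.eq_or_lt with rfl | hm
      · simp
      · rw [h hm]; ring
  · rintro x ⟨h1, h2⟩
    rw [hx x h1 h2, sub_self]

/-- Exchanging two elements of consecutive ranks moves the vertex along an edge. -/
theorem dist_rankVertex_swap_iff {d : ℕ} (B : Finset (Finset (Fin d))) {c : Fin d → ℕ}
    {i j : Fin d} (hij : c i < c j)
    (hbetween : ∀ x, x ≠ i → x ≠ j → c x < c i ∨ c j < c x) {J : Finset (Fin d)}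
    (hJ : ∀ x, x ∈ J ↔ c x ≤ c j) (z : EuclideanSpace ℝ (Fin d)) :
    dist (rankVertex B (c ∘ Equiv.swap i j)) z = dist (rankVertex B c) z ↔
      (0 < pairCount B J i j → z i - z j = (degCount B J i : ℝ) - degCount B J j) := by
  have hne : i ≠ j := by rintro rfl; exact hij.false
  have hcs : ∀ x, x ≠ i → x ≠ j → (c ∘ Equiv.swap i j) x = c x := fun x h1 h2 => by
    simp [Equiv.swap_apply_of_ne_of_ne h1 h2]
  have hci : (c ∘ Equiv.swap i j) i = c j := by simp
  have hcj : (c ∘ Equiv.swap i j) j = c i := by simp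
  have hlow : ∀ I : Finset (Fin d), (∀ y ∈ I, c y ≤ c i) ↔ I ⊆ J ∧ j ∉ I := by
    intro I
    refine ⟨fun h => ⟨fun y hy => (hJ y).2 ((h y hy).trans hij.le), fun hj => ?_⟩, ?_⟩
    · exact absurd (h j hj) hij.not_ge
    · rintro ⟨h1, h2⟩ y hy
      by_cases hyi : y = i
      · rw [hyi]
      · have hyj : y ≠ j := by rintro rfl; exact h2 hy
        have := (hJ y).1 (h1 hy)
        rcases hbetween y hyi hyj with h | h <;> omega
  have hlow' : ∀ I : Finset (Fin d),
      (∀ y ∈ I, (c ∘ Equiv.swap i j) y ≤ c i) ↔ I ⊆ J ∧ i ∉ I := by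
    intro I
    refine ⟨fun h => ⟨fun y hy => (hJ y).2 ?_, fun hi => ?_⟩, ?_⟩
    · by_cases hyi : y = i
      · rw [hyi]; exact hij.le
      by_cases hyj : y = j
      · rw [hyj]
      have := h y hy
      rw [hcs y hyi hyj] at this
      omega
    · have := h i hi
      rw [hci] at this
      omega
    · rintro ⟨h1, h2⟩ y hy
      by_cases hyj : y = j
      · rw [hyj, hcj]
      · have hyi : y ≠ i := by rintro rfl; exact h2 hy
        rw [hcs y hyi hyj]
        have := (hJ y).1 (h1 hy)
        rcases hbetween y hyi hyj with h | h <;> omega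
  have hhigh : ∀ I : Finset (Fin d), (∀ y ∈ I, c y ≤ c j) ↔ I ⊆ J := fun I =>
    ⟨fun h y hy => (hJ y).2 (h y hy), fun h y hy => (hJ y).1 (h hy)⟩
  have hhigh' : ∀ I : Finset (Fin d),
      (∀ y ∈ I, (c ∘ Equiv.swap i j) y ≤ c j) ↔ I ⊆ J := by
    intro I
    rw [← hhigh]
    refine forall₂_congr fun y _ => ?_
    by_cases hyi : y = i
    · rw [hyi, hci]; simp [hij.le]
    by_cases hyj : y = j
    · rw [hyj, hcj]; simp [hij.le]
    rw [hcs y hyi hyj]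
  have ui : rankVertex B c i = nCount (restrictTo B J) i i j := by
    rw [rankVertex_apply, nCount, restrictTo, Finset.filter_filter]
    congr 2
    ext I
    simp only [Finset.mem_filter, hlow]
    tauto
  have uj : rankVertex B c j = degCount B J j := by
    rw [rankVertex_apply, degCount, restrictTo, Finset.filter_filter]
    congr 2
    ext I
    simp only [Finset.mem_filter, hhigh]
    tauto
  have vi : rankVertex B (c ∘ Equiv.swap i j) i = degCount B J i := by
    rw [rankVertex_apply, degCount, restrictTo, Finset.filter_filter, hci]
    congr 2
    ext I
    simp only [Finset.mem_filter, hhigh']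
    tauto
  have vj : rankVertex B (c ∘ Equiv.swap i j) j = nCount (restrictTo B J) j j i := by
    rw [rankVertex_apply, nCount, restrictTo, Finset.filter_filter, hcj]
    congr 2
    ext I
    simp only [Finset.mem_filter, hlow']
    tauto
  have hdi : (degCount B J i : ℝ) = nCount (restrictTo B J) i i j + pairCount B J i j := by
    rw [degCount_eq B J i j]; push_cast; ring
  have hdj : (degCount B J j : ℝ) = nCount (restrictTo B J) j j i + pairCount B J i j := by
    rw [degCount_eq B J j i, pairCount_comm]; push_cast; ring
  rw [dist_eq_dist_iff_of_edge hne (Nat.cast_nonneg (pairCount B J i j)), ui, vj, hdi, hdj,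
    Nat.cast_pos, add_sub_add_right_eq_sub]
  · rw [ui, vi, hdi]
  · rw [uj, vj, hdj]
  · intro x hxi hxj
    rw [rankVertex_apply, rankVertex_apply, hcs x hxi hxj]
    congr 2
    refine Finset.filter_congr fun I _ => and_congr_right fun _ => forall₂_congr fun y _ => ?_
    by_cases hyi : y = i
    · rw [hyi, hci]; rcases hbetween x hxi hxj with h | h <;> omega
    by_cases hyj : y = j
    · rw [hyj, hcj]; rcases hbetween x hxi hxj with h | h <;> omega
    rw [hcs y hyi hyj]

theorem perm_function_const {d : ℕ} {α : Type*} (F : Equiv.Perm (Fin d) → α)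
    (hF : ∀ (σ : Equiv.Perm (Fin d)) (i j : Fin d), (σ j : ℕ) = σ i + 1 →
      F (σ * Equiv.swap i j) = F σ) (σ : Equiv.Perm (Fin d)) : F σ = F 1 := by
  cases d with
  | zero => exact congrArg F (Subsingleton.elim _ _)
  | succ n =>
    have hσ : σ ∈ Submonoid.closure
        (Set.range fun i : Fin n => Equiv.swap i.castSucc i.succ) := by
      rw [Equiv.Perm.mclosure_swap_castSucc_succ]; trivial
    induction hσ using Submonoid.closure_induction_left with
    | one => rfl
    | mul_left s hs τ _ ih =>
      obtain ⟨k, rfl⟩ := hs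
      rw [← ih, ← hF τ (τ⁻¹ k.castSucc) (τ⁻¹ k.succ) (by simp)]
      congr 1
      simp [Equiv.mul_swap_eq_swap_mul]

theorem exists_consecutive_ranking {d : ℕ} {J : Finset (Fin d)} {i j : Fin d} (hi : i ∈ J)
    (hj : j ∈ J) (hij : i ≠ j) :
    ∃ c : Fin d → ℕ, Function.Injective c ∧ c i < c j ∧
      (∀ x, x ≠ i → x ≠ j → c x < c i ∨ c j < c x) ∧ ∀ x, x ∈ J ↔ c x ≤ c j := by
  refine ⟨fun x => if x = i then d else if x = j then d + 1 else
    if x ∈ J then (x : ℕ) else d + 2 + x, ?_, ?_, ?_, ?_⟩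
  · intro x y h
    have := x.isLt
    have := y.isLt
    simp only at h
    ext
    grind
  · grind
  · intro x _ _
    have := x.isLt
    grind
  · intro x
    have := x.isLt
    grind

theorem isInscribed_nestohedron_iff {d : ℕ} {B : Finset (Finset (Fin d))}
    (hB : ∀ I ∈ B, I.Nonempty) :
    IsInscribed (nestohedron B) ↔ ∃ z : Fin d → ℝ, ∀ J : Finset (Fin d), ∀ i ∈ J, ∀ j ∈ J,
      0 < pairCount B J i j → z i - z j = (degCount B J i : ℝ) - degCount B J j := by
  constructor
  · rintro ⟨z, r, hz⟩
    refine ⟨z, fun J i hi j hj => ?_⟩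
    rcases eq_or_ne i j with rfl | hij
    · simp
    obtain ⟨c, hc, hlt, hbetween, hJ⟩ := exists_consecutive_ranking hi hj hij
    refine (dist_rankVertex_swap_iff B hlt hbetween hJ z).1 ?_
    rw [hz _ (rankVertex_mem_extremePoints hB hc),
      hz _ (rankVertex_mem_extremePoints hB (hc.comp (Equiv.injective _)))]
  · rintro ⟨z, hz⟩
    refine ⟨WithLp.toLp 2 z,
      dist (rankVertex B fun x => ((1 : Equiv.Perm (Fin d)) x : ℕ)) (WithLp.toLp 2 z), ?_⟩
    intro v hv
    obtain ⟨σ, rfl⟩ := exists_perm_of_mem_extremePoints hB hv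
    refine perm_function_const
      (fun σ => dist (rankVertex B fun x => (σ x : ℕ)) (WithLp.toLp 2 z)) ?_ σ
    intro σ i j hij
    have hbetween : ∀ x, x ≠ i → x ≠ j → (σ x : ℕ) < σ i ∨ (σ j : ℕ) < σ x := by
      intro x hxi hxj
      have h1 : (σ x : ℕ) ≠ σ i := fun h => hxi (perm_val_injective σ h)
      have h2 : (σ x : ℕ) ≠ σ j := fun h => hxj (perm_val_injective σ h)
      omega
    have hJ : ∀ x, x ∈ Finset.univ.filter (fun x => (σ x : ℕ) ≤ σ j) ↔ (σ x : ℕ) ≤ σ j := by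
      simp
    have hlt : (σ i : ℕ) < σ j := by omega
    exact (dist_rankVertex_swap_iff B (c := fun x => (σ x : ℕ)) hlt hbetween hJ
      (WithLp.toLp 2 z)).2 (hz _ i ((hJ i).2 hlt.le) j ((hJ j).2 le_rfl))

/-! ### Counting -/

theorem nCount_swap {d : ℕ} (B : Finset (Finset (Fin d))) (i j k : Fin d) :
    nCount B i j k = nCount B j i k := by
  simp only [nCount, and_left_comm]

theorem degCount_erase {d : ℕ} (B : Finset (Finset (Fin d))) (J : Finset (Fin d))
    (i k : Fin d) : degCount B J i = degCount B (J.erase k) i + pairCount B J i k := by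
  have h := degCount_eq B J i k
  have h2 : nCount (restrictTo B J) i i k = degCount B (J.erase k) i := by
    simp only [nCount, degCount, restrictTo, Finset.filter_filter]
    congr 1
    ext I
    simp only [Finset.mem_filter, Finset.subset_erase]
    tauto
  omega

theorem pairCount_eq_add {d : ℕ} (B : Finset (Finset (Fin d))) (J : Finset (Fin d))
    (i j k : Fin d) : pairCount B J i j =
      ((restrictTo B J).filter fun I => i ∈ I ∧ j ∈ I ∧ k ∈ I).card
        + nCount (restrictTo B J) i j k := by
  rw [pairCount, nCount, ← Finset.card_filter_add_card_filter_not (fun I => k ∈ I),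
    Finset.filter_filter, Finset.filter_filter]
  simp only [and_assoc]

theorem pairCount_eq_pairCount_iff {d : ℕ} (B : Finset (Finset (Fin d)))
    (J : Finset (Fin d)) (i j k : Fin d) :
    pairCount B J i k = pairCount B J j k ↔
      nCount (restrictTo B J) i k j = nCount (restrictTo B J) j k i := by
  have h1 := pairCount_eq_add B J i k j
  have h2 := pairCount_eq_add B J j k i
  have h3 : ((restrictTo B J).filter fun I => i ∈ I ∧ k ∈ I ∧ j ∈ I)
      = (restrictTo B J).filter fun I => j ∈ I ∧ k ∈ I ∧ i ∈ I := by
    ext I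
    simp only [Finset.mem_filter]
    tauto
  rw [h3] at h1
  omega

theorem nCount_pos_iff {d : ℕ} (B : Finset (Finset (Fin d))) (J : Finset (Fin d))
    (i j k : Fin d) :
    0 < nCount (restrictTo B J) i j k ↔ 0 < pairCount B (J.erase k) i j := by
  have : nCount (restrictTo B J) i j k = pairCount B (J.erase k) i j := by
    simp only [nCount, pairCount, restrictTo, Finset.filter_filter]
    congr 1
    ext I
    simp only [Finset.mem_filter, Finset.subset_erase]
    tauto
  rw [this]

theorem pairCount_mono {d : ℕ} (B : Finset (Finset (Fin d))) {J K : Finset (Fin d)}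
    (h : J ⊆ K) (i j : Fin d) : pairCount B J i j ≤ pairCount B K i j := by
  refine Finset.card_le_card fun I hI => ?_
  simp only [restrictTo, Finset.mem_filter] at hI ⊢
  exact ⟨⟨hI.1.1, hI.1.2.trans h⟩, hI.2⟩

/-- If the members of `B` in `J \ k` already determine the difference of the centre coordinates
at `i` and `j`, then adding `k` must not change it. -/
theorem pairCount_eq_of_center {d : ℕ} {B : Finset (Finset (Fin d))} {z : Fin d → ℝ}
    (hz : ∀ J : Finset (Fin d), ∀ i ∈ J, ∀ j ∈ J,
      0 < pairCount B J i j → z i - z j = (degCount B J i : ℝ) - degCount B J j)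
    {J : Finset (Fin d)} {i j k : Fin d} (hi : i ∈ J) (hj : j ∈ J)
    (h : 0 < nCount (restrictTo B J) i j k) :
    nCount (restrictTo B J) i k j = nCount (restrictTo B J) j k i := by
  rw [← pairCount_eq_pairCount_iff]
  have hne : i ≠ k ∧ j ≠ k := by
    obtain ⟨I, hI⟩ := Finset.card_pos.1 h
    simp only [Finset.mem_filter] at hI
    exact ⟨fun e => hI.2.2.2 (e ▸ hI.2.1), fun e => hI.2.2.2 (e ▸ hI.2.2.1)⟩
  rw [nCount_pos_iff] at h
  have h1 := hz _ i (Finset.mem_erase.2 ⟨hne.1, hi⟩) j (Finset.mem_erase.2 ⟨hne.2, hj⟩) h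
  have h2 := hz J i hi j hj (h.trans_le (pairCount_mono B (Finset.erase_subset _ _) i j))
  rw [degCount_erase B J i k, degCount_erase B J j k, h1] at h2
  push_cast at h2
  have : (pairCount B J i k : ℝ) = pairCount B J j k := by linarith
  exact_mod_cast this

theorem degCount_sub_eq_univ {d : ℕ} {B : Finset (Finset (Fin d))}
    (h : ∀ J : Finset (Fin d), ∀ i ∈ J, ∀ j ∈ J, ∀ k ∈ J,
      0 < nCount (restrictTo B J) i j k → 0 < nCount (restrictTo B J) j k i →
        nCount (restrictTo B J) i j k = nCount (restrictTo B J) j k i ∧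
        nCount (restrictTo B J) j k i = nCount (restrictTo B J) i k j)
    (J : Finset (Fin d)) (i : Fin d) (hi : i ∈ J) (j : Fin d) (hj : j ∈ J)
    (hpos : 0 < pairCount B J i j) :
    (degCount B Finset.univ i : ℝ) - degCount B Finset.univ j
      = (degCount B J i : ℝ) - degCount B J j := by
  suffices hK : ∀ K : Finset (Fin d), (degCount B (J ∪ K) i : ℝ) - degCount B (J ∪ K) j
      = (degCount B J i : ℝ) - degCount B J j by
    rw [← hK Finset.univ, Finset.union_eq_right.2 (Finset.subset_univ J)]
  intro K
  induction K using Finset.induction_on with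
  | empty => simp
  | insert k K _ ih =>
    rw [Finset.union_insert]
    by_cases hk : k ∈ J ∪ K
    · rwa [Finset.insert_eq_of_mem hk]
    have hkJ : k ∈ insert k (J ∪ K) := Finset.mem_insert_self _ _
    have hiJ : i ∈ insert k (J ∪ K) := by simp [hi]
    have hjJ : j ∈ insert k (J ∪ K) := by simp [hj]
    have herase := Finset.erase_insert hk
    have hij : 0 < nCount (restrictTo B (insert k (J ∪ K))) i j k := by
      rw [nCount_pos_iff, herase]
      exact hpos.trans_le (pairCount_mono B Finset.subset_union_left i j)
    have hpair : pairCount B (insert k (J ∪ K)) i k = pairCount B (insert k (J ∪ K)) j k := by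
      rw [pairCount_eq_pairCount_iff]
      have h1 := h _ i hiJ j hjJ k hkJ hij
      have h2 := h _ j hjJ i hiJ k hkJ (by rwa [nCount_swap])
      rw [nCount_swap _ j i k] at h2
      omega
    rw [degCount_erase B _ i k, degCount_erase B _ j k, herase, hpair]
    push_cast
    linarith

theorem exists_center_iff {d : ℕ} (B : Finset (Finset (Fin d))) :
    (∃ z : Fin d → ℝ, ∀ J : Finset (Fin d), ∀ i ∈ J, ∀ j ∈ J,
      0 < pairCount B J i j → z i - z j = (degCount B J i : ℝ) - degCount B J j) ↔
    ∀ J : Finset (Fin d), ∀ i ∈ J, ∀ j ∈ J, ∀ k ∈ J,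
      0 < nCount (restrictTo B J) i j k → 0 < nCount (restrictTo B J) j k i →
        nCount (restrictTo B J) i j k = nCount (restrictTo B J) j k i ∧
        nCount (restrictTo B J) j k i = nCount (restrictTo B J) i k j := by
  constructor
  · rintro ⟨z, hz⟩ J i hi j hj k hk h1 h2
    have e1 := pairCount_eq_of_center hz hi hj h1
    have e2 := pairCount_eq_of_center hz hj hk h2
    rw [nCount_swap _ j i k, nCount_swap _ k i j] at e2
    exact ⟨by omega, e1.symm⟩
  · intro h
    exact ⟨fun i => degCount B Finset.univ i, degCount_sub_eq_univ h⟩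

/-! ### Graph associahedra -/

theorem mem_graphicalBuildingSet {d : ℕ} {G : SimpleGraph (Fin d)} {I : Finset (Fin d)} :
    I ∈ graphicalBuildingSet G ↔
      I.Nonempty ∧ (G.induce (I : Set (Fin d))).Connected := by
  simp [graphicalBuildingSet]

theorem pair_mem_graphicalBuildingSet {d : ℕ} {G : SimpleGraph (Fin d)} {i j : Fin d}
    (hij : i ≠ j) : ({i, j} : Finset (Fin d)) ∈ graphicalBuildingSet G ↔ G.Adj i j := by
  rw [mem_graphicalBuildingSet, Finset.coe_pair]
  refine ⟨fun h => ?_, fun h =>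
    ⟨Finset.insert_nonempty _ _, SimpleGraph.induce_pair_connected_of_adj h⟩⟩
  obtain ⟨p⟩ := h.2.preconnected ⟨i, by simp⟩ ⟨j, by simp⟩
  cases p with
  | nil => exact absurd rfl hij
  | cons hadj _ =>
    rename_i w _
    obtain ⟨w, hw⟩ := w
    have hadj' : G.Adj i w := hadj
    rcases hw with rfl | rfl
    · exact absurd hadj' (G.loopless.irrefl _)
    · exact hadj'

theorem mem_graphicalBuildingSet_of_setoid {d : ℕ} {G : SimpleGraph (Fin d)}
    {s : Setoid (Fin d)} (hs : ∀ u v, G.Adj u v ↔ u ≠ v ∧ s u v) {I : Finset (Fin d)} :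
    I ∈ graphicalBuildingSet G ↔ I.Nonempty ∧ ∀ u ∈ I, ∀ v ∈ I, s u v := by
  rw [mem_graphicalBuildingSet]
  refine and_congr_right fun hne => ⟨fun h u hu v hv => ?_, fun h => ?_⟩
  · obtain ⟨p⟩ := h.preconnected ⟨u, hu⟩ ⟨v, hv⟩
    have key : ∀ {a b : (I : Set (Fin d))}, (G.induce (I : Set (Fin d))).Walk a b →
        s a.1 b.1 := by
      intro a b q
      induction q with
      | nil => exact s.refl _
      | cons hadj _ ih => exact s.trans ((hs _ _).1 hadj).2 ih
    exact key p
  · have : Nonempty (I : Set (Fin d)) := hne.coe_sort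
    refine SimpleGraph.Connected.mk fun u v => ?_
    by_cases huv : u = v
    · rw [huv]
    · refine SimpleGraph.Adj.reachable ?_
      exact (hs _ _).2 ⟨fun e => huv (Subtype.ext e), h _ u.2 _ v.2⟩

theorem degCount_eq_of_setoid {d : ℕ} {G : SimpleGraph (Fin d)}
    {s : Setoid (Fin d)} (hs : ∀ u v, G.Adj u v ↔ u ≠ v ∧ s u v) {J : Finset (Fin d)}
    {i j : Fin d} (hi : i ∈ J) (hj : j ∈ J) (hij : s i j) :
    degCount (graphicalBuildingSet G) J i = degCount (graphicalBuildingSet G) J j := by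
  have hswap : ∀ x, s (Equiv.swap i j x) x := by
    intro x
    rw [Equiv.swap_apply_def]
    split_ifs with h1 h2
    · exact h1 ▸ s.symm hij
    · exact h2 ▸ hij
    · exact s.refl x
  have hinv : ∀ I : Finset (Fin d),
      (I.image (Equiv.swap i j)).image (Equiv.swap i j) = I := by
    intro I
    simp [Finset.image_image, Function.comp_def]
  have hmem : ∀ I ∈ restrictTo (graphicalBuildingSet G) J,
      I.image (Equiv.swap i j) ∈ restrictTo (graphicalBuildingSet G) J := by
    intro I hI
    simp only [restrictTo, Finset.mem_filter, mem_graphicalBuildingSet_of_setoid hs] at hI ⊢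
    obtain ⟨⟨hne, hrel⟩, hsub⟩ := hI
    refine ⟨⟨hne.image _, ?_⟩, ?_⟩
    · intro u hu v hv
      obtain ⟨x, hx, rfl⟩ := Finset.mem_image.1 hu
      obtain ⟨y, hy, rfl⟩ := Finset.mem_image.1 hv
      exact s.trans (hswap x) (s.trans (hrel x hx y hy) (s.symm (hswap y)))
    · intro u hu
      obtain ⟨x, hx, rfl⟩ := Finset.mem_image.1 hu
      rw [Equiv.swap_apply_def]
      split_ifs
      · exact hj
      · exact hi
      · exact hsub hx
  refine Finset.card_nbij' (fun I => I.image (Equiv.swap i j))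
    (fun I => I.image (Equiv.swap i j)) ?_ ?_ (fun I _ => hinv I) (fun I _ => hinv I)
  · intro I hI
    obtain ⟨h1, h2⟩ := Finset.mem_filter.1 (Finset.mem_coe.1 hI)
    exact Finset.mem_coe.2 (Finset.mem_filter.2
      ⟨hmem I h1, Finset.mem_image.2 ⟨i, h2, Equiv.swap_apply_left i j⟩⟩)
  · intro I hI
    obtain ⟨h1, h2⟩ := Finset.mem_filter.1 (Finset.mem_coe.1 hI)
    exact Finset.mem_coe.2 (Finset.mem_filter.2
      ⟨hmem I h1, Finset.mem_image.2 ⟨j, h2, Equiv.swap_apply_right i j⟩⟩)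

theorem isInscribed_graphAssociahedron_iff {d : ℕ} (G : SimpleGraph (Fin d)) :
    IsInscribed (nestohedron (graphicalBuildingSet G)) ↔ IsDisjointUnionOfComplete G := by
  rw [isInscribed_nestohedron_iff fun I hI => (mem_graphicalBuildingSet.1 hI).1]
  constructor
  · intro h
    rw [exists_center_iff] at h
    have hpos : ∀ {J : Finset (Fin d)} {i j k : Fin d}, i ∈ J → j ∈ J → i ≠ k → j ≠ k →
        G.Adj i j → 0 < nCount (restrictTo (graphicalBuildingSet G) J) i j k := by
      intro J i j k hi hj hik hjk hadj
      refine Finset.card_pos.2 ⟨{i, j}, ?_⟩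
      simp [restrictTo, pair_mem_graphicalBuildingSet hadj.ne, hadj, Finset.insert_subset_iff,
        hi, hj, hik.symm, hjk.symm]
    have htrans : ∀ i j k, G.Adj i j → G.Adj j k → i ≠ k → G.Adj i k := by
      intro i j k hij hjk hik
      have h1 := hpos (J := {i, j, k}) (by simp) (by simp) hik hjk.ne hij
      have h2 := hpos (J := {i, j, k}) (by simp) (by simp) hij.ne' hik.symm hjk
      obtain ⟨e1, e2⟩ := h {i, j, k} i (by simp) j (by simp) k (by simp) h1 h2
      rw [e2] at h2
      obtain ⟨I, hI⟩ := Finset.card_pos.1 h2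
      simp only [restrictTo, Finset.mem_filter] at hI
      obtain ⟨⟨hIB, hsub⟩, hiI, hkI, hjI⟩ := hI
      have hIe : I = {i, k} := by
        ext x
        have := @hsub x
        simp only [Finset.mem_insert, Finset.mem_singleton] at this ⊢
        grind
      rwa [hIe, pair_mem_graphicalBuildingSet hik] at hIB
    refine ⟨⟨fun u v => u = v ∨ G.Adj u v, fun u => Or.inl rfl, ?_, ?_⟩, fun u v => ?_⟩
    · rintro u v (rfl | huv)
      exacts [Or.inl rfl, Or.inr huv.symm]
    · rintro u v w (rfl | huv) (rfl | hvw)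
      · exact Or.inl rfl
      · exact Or.inr hvw
      · exact Or.inr huv
      · by_cases huw : u = w
        exacts [Or.inl huw, Or.inr (htrans u v w huv hvw huw)]
    · refine ⟨fun huv => ⟨huv.ne, Or.inr huv⟩, ?_⟩
      rintro ⟨hne, rfl | huv⟩
      exacts [absurd rfl hne, huv]
  · rintro ⟨s, hs⟩
    refine ⟨0, fun J i hi j hj hpos => ?_⟩
    obtain ⟨I, hI⟩ := Finset.card_pos.1 hpos
    simp only [restrictTo, Finset.mem_filter] at hI
    have hij := ((mem_graphicalBuildingSet_of_setoid hs).1 hI.1.1).2 i hI.2.1 j hI.2.2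
    simp [degCount_eq_of_setoid hs hi hj hij]

theorem mainTheorem8 (d : ℕ) :
    (∀ B : Finset (Finset (Fin d)), IsBuildingSet B →
      (IsInscribed (nestohedron B) ↔
        ∀ J : Finset (Fin d), ∀ i ∈ J, ∀ j ∈ J, ∀ k ∈ J,
          0 < nCount (restrictTo B J) i j k → 0 < nCount (restrictTo B J) j k i →
            nCount (restrictTo B J) i j k = nCount (restrictTo B J) j k i ∧
            nCount (restrictTo B J) j k i = nCount (restrictTo B J) i k j)) ∧
    (∀ G : SimpleGraph (Fin d),
      IsInscribed (nestohedron (graphicalBuildingSet G)) ↔ IsDisjointUnionOfComplete G) :=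
  ⟨fun B hB => (isInscribed_nestohedron_iff hB.nonempty).trans (exists_center_iff B),
    isInscribed_graphAssociahedron_iff⟩
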